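/- Let $\mathbb F$ be a field, let $s\ge 0$ and $d=2s+1$, and let $P(\lambda)=\sum_{k=0}^{d}P_k\lambda^k\in\mathbb F[\lambda]^{n\times n}$ be a matrix polynomial of odd degree $d$ that is singular, i.e. $\det P(\lambda)\equiv 0$. Let $L_s(\lambda)\in\mathbb F[\lambda]^{s\times(s+1)}$ be the pencil with $-1$ in the positions $(i,i)$, $\lambda$ in the positions $(i,i+1)$ and zeros elsewhere, let $\Lambda_s(\lambda)=[\lambda^s,\dots,\lambda,1]^T$, let $\sigma\in\{1,-1\}$, and let $$\mathcal L(\lambda)=\begin{bmatrix}\lambda B+A & L_s(\lambda)^T\otimes I_n\\ \sigma L_s(\lambda)\otimes I_n&0\end{bmatrix},\qquad A,B\in\mathbb F^{(s+1)n\times(s+1)n},$$ be a block Kronecker pencil associated with $P$ in the sense that $$P(\lambda)=(\Lambda_s(\lambda)^T\otimes I_n)(\lambda B+A)(\Lambda_s(\lambda)\otimes I_n)$$ (this is the condition that makes $\mathcal L$ a block Kronecker strong linearization of $P$). The right nullspace of a matrix polynomial $Q(\lambda)$ with $m$ columns is $\mathcal N_r(Q)=\{x\in\mathbb F(\lambda)^{m}: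 Qx=0\}$. A right minimal basis of $Q$ is a basis of $\mathcal N_r(Q)$ over $\mathbb F(\lambda)$ that consists of vector polynomials and whose sum of degrees is least among all such bases; the right minimal indices of $Q$ are the degrees of the vectors of a right minimal basis, in nondecreasing order. Partition vectors of length $dn$ into $d$ blocks of length $n$. (a) If $\{z_1,\dots,z_p\}$ is any right minimal basis of $\mathcal L$ and $x_j$ is the $(s+1)$-th block of $z_j$, then $\{x_1,\dots,x_p\}$ is a right minimal basis of $P$. (b) If $\epsilon_1\le\dots\le\epsilon_p$ are the right minimal indices of $P$, then $\epsilon_1+s\le\dots\le\epsilon_p+s$ are the right minimal indices of $\mathcal L$ (these, and no other list). -/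

import Mathlib

open Polynomial
open scoped Kronecker

noncomputable section

/-- The square matrix polynomial `P` has degree `d`: its coefficient matrix at `d` is nonzero and
all higher coefficient matrices vanish. -/
def HasMatrixDegree {F : Type*} [Field F] {m : Type*}
    (P : Matrix m m F[X]) (d : ℕ) : Prop :=
  (∃ i j, (P i j).coeff d ≠ 0) ∧ ∀ k, d < k → ∀ i j, (P i j).coeff k = 0

/-- The degree of a vector polynomial: the largest degree of its entries. -/
def vecDegree {F : Type*} [Field F] {ι : Type*} [Fintype ι] (v : ι → F[X]) : ℕ :=
  Finset.univ.sup fun i => (v i).natDegree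

/-- A vector polynomial regarded as a vector of rational functions. -/
def toRational {F : Type*} [Field F] {ι : Type*} (v : ι → F[X]) : ι → RatFunc F :=
  fun i => algebraMap F[X] (RatFunc F) (v i)

/-- The right nullspace of a matrix polynomial, over the field of rational functions. -/
def rightNullspace {F : Type*} [Field F] {m ι : Type*} [Fintype ι]
    (P : Matrix m ι F[X]) : Submodule (RatFunc F) (ι → RatFunc F) :=
  LinearMap.ker (P.map (algebraMap F[X] (RatFunc F))).mulVecLin

/-- The vector polynomials `x j` form a basis of the rational subspace `V`. -/
def IsPolynomialBasis {F : Type*} [Field F] {ι : Type*} {p : ℕ}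
    (V : Submodule (RatFunc F) (ι → RatFunc F)) (x : Fin p → ι → F[X]) : Prop :=
  LinearIndependent (RatFunc F) (fun j => toRational (x j)) ∧
    Submodule.span (RatFunc F) (Set.range fun j => toRational (x j)) = V

/-- A minimal basis of `V`: a polynomial basis whose order (the sum of the degrees of its vectors)
is least among all polynomial bases of `V`. -/
def IsMinimalBasis {F : Type*} [Field F] {ι : Type*} [Fintype ι] {p : ℕ}
    (V : Submodule (RatFunc F) (ι → RatFunc F)) (x : Fin p → ι → F[X]) : Prop :=
  IsPolynomialBasis V x ∧
    ∀ (q : ℕ) (y : Fin q → ι → F[X]), IsPolynomialBasis V y →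
      ∑ j, vecDegree (x j) ≤ ∑ j, vecDegree (y j)

/-- A right minimal basis of a matrix polynomial: a minimal basis of its right nullspace. -/
def IsRightMinimalBasis {F : Type*} [Field F] {m ι : Type*} [Fintype ι] {p : ℕ}
    (P : Matrix m ι F[X]) (x : Fin p → ι → F[X]) : Prop :=
  IsMinimalBasis (rightNullspace P) x

/-- `ε` is the list of right minimal indices of `P`: the list of the degrees of a right minimal
basis of `P` that is ordered by nondecreasing degree. -/
def IsRightMinimalIndices {F : Type*} [Field F] {m ι : Type*} [Fintype ι]
    (P : Matrix m ι F[X]) (ε : List ℕ) : Prop :=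
  ∃ (p : ℕ) (x : Fin p → ι → F[X]), IsRightMinimalBasis P x ∧
    Monotone (fun j => vecDegree (x j)) ∧ ε = List.ofFn fun j => vecDegree (x j)

/-- The `k × (k+1)` pencil `L_k(λ)` with `-1` on the diagonal and `λ` on the superdiagonal. -/
def kronL (F : Type*) [Field F] (k : ℕ) : Matrix (Fin k) (Fin (k + 1)) F[X] :=
  Matrix.of fun i j => if j = i.castSucc then -1 else if j = i.succ then X else 0

/-- The column `Λ_k(λ) = (λ^k, …, λ, 1)ᵀ`. -/
def kronLambda (F : Type*) [Field F] (k : ℕ) : Matrix (Fin (k + 1)) Unit F[X] :=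
  Matrix.of fun i _ => X ^ (k - (i : ℕ))

/-- `Λ_s(λ) ⊗ I_n`, with its columns indexed by `Fin n` instead of `Unit × Fin n`. -/
def lambdaKron (F : Type*) [Field F] (s n : ℕ) :
    Matrix (Fin (s + 1) × Fin n) (Fin n) F[X] :=
  (kronLambda F s ⊗ₖ (1 : Matrix (Fin n) (Fin n) F[X])).submatrix id fun a => ((), a)

/-- The pencil `λB + A`. -/
def pencil {F : Type*} [Field F] {m ι : Type*} (A B : Matrix m ι F) : Matrix m ι F[X] :=
  (X : F[X]) • B.map C + A.map C

/-- The block Kronecker pencil with parameters `σ` and `λB + A`. The index `Sum.inl (i, a)` is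
entry `a` of block `i + 1`, and `Sum.inr (i, a)` is entry `a` of block `s + 2 + i`. -/
def blockKroneckerPencil {F : Type*} [Field F] {s n : ℕ} (σ : F)
    (A B : Matrix (Fin (s + 1) × Fin n) (Fin (s + 1) × Fin n) F) :
    Matrix ((Fin (s + 1) × Fin n) ⊕ (Fin s × Fin n))
      ((Fin (s + 1) × Fin n) ⊕ (Fin s × Fin n)) F[X] :=
  Matrix.fromBlocks (pencil A B)
    ((kronL F s).transpose ⊗ₖ (1 : Matrix (Fin n) (Fin n) F[X]))
    (C σ • (kronL F s ⊗ₖ (1 : Matrix (Fin n) (Fin n) F[X]))) 0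

/-- The relation between `P` and the body `λB + A` of a block Kronecker pencil by which the pencil
is obtained as a strong linearization of `P` of grade `2s + 1`:
`P(λ) = (Λ_s(λ)ᵀ ⊗ I_n) (λB + A) (Λ_s(λ) ⊗ I_n)`. -/
def BodyRepresents {F : Type*} [Field F] {s n : ℕ}
    (A B : Matrix (Fin (s + 1) × Fin n) (Fin (s + 1) × Fin n) F)
    (P : Matrix (Fin n) (Fin n) F[X]) : Prop :=
  P = (lambdaKron F s n).transpose * pencil A B * lambdaKron F s n

end

/-!
A null vector `z = (u, w)` of the block Kronecker pencil has `(L_s ⊗ I) u = 0`, hence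
`u = (Λ_s ⊗ I) x` with `x` the last block of `u`
(`blockKroneckerPencil_mulVec_eq_zero_iff`). The remaining equations, with
`V = (λB + A) (Λ_s ⊗ I) x`, form a recurrence `w_j = V_j + λ w_{j-1}` with both ends zero. It has at
most one solution, and by Horner's scheme it has one exactly when `Λ_sᵀ V = P x` vanishes
(`recurrence_last_eq_sum`). Thus `z ↦ x` is an isomorphism of the right nullspaces which also is a
bijection between their polynomial vectors.

If `x ≠ 0`, then `u` has degree `deg x + s`, and `V` has degree at most `deg x + s + 1`. Solving the
recurrence from the last block backwards shows that `w` has degree at most `deg x + s`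
(`natDegree_recurrence_le`). So `deg z = deg x + s`, and since all bases of a nullspace have the same
cardinality, the orders of corresponding bases differ by a constant: minimal bases correspond to
minimal bases (`NullspaceProjection.isRightMinimalBasis_iff`).

This gives the shifted degrees for one minimal basis of the pencil. That no other list of minimal
indices occurs is the uniqueness of minimal indices (`IsRightMinimalIndices.unique`), which follows
from Steinitz exchange: if two ordered minimal bases had different degrees at some place, a vector of
one could replace a vector of larger degree in the other.
-/

/-! ### Polynomial vectors in rational nullspaces -/

section Rational

variable {F : Type*} [Field F] {m ι : Type*} [Fintype ι]

theorem toRational_mem_rightNullspace_iff (Q : Matrix m ι F[X]) (z : ι → F[X]) :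
    toRational z ∈ rightNullspace Q ↔ Q.mulVec z = 0 := by
  have h : (Q.map (algebraMap F[X] (RatFunc F))).mulVec (toRational z)
      = toRational (Q.mulVec z) :=
    (funext (RingHom.map_mulVec (algebraMap F[X] (RatFunc F)) Q z)).symm
  rw [rightNullspace, LinearMap.mem_ker, Matrix.mulVecLin_apply, h]
  constructor
  · intro h0
    ext1 i
    exact (FaithfulSMul.algebraMap_injective F[X] (RatFunc F))
      ((congrFun h0 i).trans (map_zero _).symm)
  · intro h0
    ext1 i
    simp [toRational, h0]

/-- Clearing denominators: every rational vector is a nonzero multiple of a polynomial one. Through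
this lemma, statements about rational nullspaces reduce to statements about polynomial vectors. -/
theorem exists_smul_eq_toRational (v : ι → RatFunc F) :
    ∃ (c : RatFunc F) (z : ι → F[X]), c ≠ 0 ∧ c • v = toRational z := by
  obtain ⟨b, hb⟩ := IsLocalization.exist_integer_multiples_of_finite (nonZeroDivisors F[X]) v
  choose z hz using hb
  refine ⟨algebraMap F[X] (RatFunc F) b, z, ?_, ?_⟩
  · simp
  · ext1 i
    rw [toRational, hz i, Pi.smul_apply, smul_eq_mul]
    exact (Algebra.smul_def (b : F[X]) (v i)).symm

end Rational

/-! ### Exchange in polynomial bases and uniqueness of minimal indices -/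

section Exchange

variable {F : Type*} [Field F] {ι : Type*} {p : ℕ}
  {V : Submodule (RatFunc F) (ι → RatFunc F)}

theorem IsPolynomialBasis.finrank_eq {x : Fin p → ι → F[X]} (hx : IsPolynomialBasis V x) :
    Module.finrank (RatFunc F) V = p := by
  rw [← hx.2, finrank_span_eq_card hx.1, Fintype.card_fin]

theorem IsPolynomialBasis.card_eq {q : ℕ} {x : Fin p → ι → F[X]} {y : Fin q → ι → F[X]}
    (hx : IsPolynomialBasis V x) (hy : IsPolynomialBasis V y) : p = q :=
  hx.finrank_eq.symm.trans hy.finrank_eq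

theorem IsPolynomialBasis.ne_zero {z : Fin p → ι → F[X]} (hz : IsPolynomialBasis V z)
    (j : Fin p) : z j ≠ 0 := by
  intro h0
  refine hz.1.ne_zero j ?_
  ext1 i
  simp [toRational, h0]

/-- Steinitz exchange: a basis vector may be replaced by any polynomial vector whose expansion in
the basis involves it. -/
theorem IsPolynomialBasis.update {y : Fin p → ι → F[X]} (hy : IsPolynomialBasis V y)
    {v : ι → F[X]} {c : Fin p → RatFunc F} (hv : toRational v = ∑ j, c j • toRational (y j))
    {l : Fin p} (hl : c l ≠ 0) : IsPolynomialBasis V (Function.update y l v) := by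
  have hspan : Submodule.span (RatFunc F)
      (Set.range fun j => toRational (Function.update y l v j)) = V := by
    have hmem : ∀ j, j ≠ l → toRational (y j) ∈ Submodule.span (RatFunc F)
        (Set.range fun j => toRational (Function.update y l v j)) := fun j hj =>
      Submodule.subset_span ⟨j, by simp [Function.update_of_ne hj]⟩
    have hvmem : toRational v ∈ Submodule.span (RatFunc F)
        (Set.range fun j => toRational (Function.update y l v j)) :=
      Submodule.subset_span ⟨l, by simp⟩
    apply le_antisymm
    · rw [Submodule.span_le, Set.range_subset_iff]
      have hyV : ∀ j, toRational (y j) ∈ V := fun j => hy.2 ▸ Submodule.subset_span ⟨j, rfl⟩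
      intro j
      by_cases hj : j = l
      · subst hj
        simp only [Function.update_self, hv]
        exact Submodule.sum_mem _ fun i _ => Submodule.smul_mem _ _ (hyV i)
      · simpa [Function.update_of_ne hj] using hyV j
    · rw [← hy.2, Submodule.span_le, Set.range_subset_iff]
      intro j
      by_cases hj : j = l
      · subst hj
        have h : toRational (y j) = (c j)⁻¹ • (toRational v -
            ∑ i ∈ Finset.univ.erase j, c i • toRational (y i)) := by
          rw [hv, ← Finset.add_sum_erase _ _ (Finset.mem_univ j), add_sub_cancel_right,
            smul_smul, inv_mul_cancel₀ hl, one_smul]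
        rw [SetLike.mem_coe, h]
        exact Submodule.smul_mem _ _ (Submodule.sub_mem _ hvmem (Submodule.sum_mem _ fun i hi =>
          Submodule.smul_mem _ _ (hmem i (Finset.ne_of_mem_erase hi))))
      · exact hmem j hj
  refine ⟨?_, hspan⟩
  rw [linearIndependent_iff_card_eq_finrank_span, Set.finrank, hspan, hy.finrank_eq,
    Fintype.card_fin]

/-- In an ordered polynomial basis, no degree is smaller than the degree at the same place of an
ordered minimal basis. Otherwise exchange would produce a basis of smaller order. -/
theorem IsMinimalBasis.vecDegree_le [Fintype ι] {x y : Fin p → ι → F[X]}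
    (hy : IsMinimalBasis V y) (hx : IsPolynomialBasis V x)
    (hxm : Monotone fun j => vecDegree (x j)) (hym : Monotone fun j => vecDegree (y j))
    (k : Fin p) : vecDegree (y k) ≤ vecDegree (x k) := by
  by_contra! hlt
  -- The `k + 1` vectors `x 0, …, x k` cannot all lie in the span of the `k` vectors
  -- `y 0, …, y (k - 1)`.
  obtain ⟨i, hik, hi⟩ : ∃ i ≤ k, toRational (x i) ∉
      Submodule.span (RatFunc F) (Set.range fun j : Fin k =>
        toRational (y (j.castLE k.2.le))) := by
    by_contra! hall
    have hli : LinearIndependent (RatFunc F)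
        (fun j : Fin (k + 1) => toRational (x (j.castLE k.2))) :=
      hx.1.comp _ (Fin.castLE_injective _)
    have h1 := finrank_span_eq_card hli
    have h2 : Submodule.span (RatFunc F)
        (Set.range fun j : Fin (k + 1) => toRational (x (j.castLE k.2))) ≤
        Submodule.span (RatFunc F) (Set.range fun j : Fin k =>
          toRational (y (j.castLE k.2.le))) := by
      rw [Submodule.span_le, Set.range_subset_iff]
      exact fun j => hall _ (Fin.le_def.2 (Nat.lt_succ_iff.1 j.2))
    have h3 := (Submodule.finrank_mono h2).trans (finrank_range_le_card _)
    rw [h1] at h3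
    simp at h3
  have hiV : toRational (x i) ∈ V := hx.2 ▸ Submodule.subset_span ⟨i, rfl⟩
  rw [← hy.1.2, Submodule.mem_span_range_iff_exists_fun] at hiV
  obtain ⟨c, hc⟩ := hiV
  obtain ⟨l, hkl, hl⟩ : ∃ l, k ≤ l ∧ c l ≠ 0 := by
    by_contra! hall
    refine hi (hc ▸ Submodule.sum_mem _ fun j _ => ?_)
    by_cases hj : k ≤ j
    · simp [hall j hj]
    · exact Submodule.smul_mem _ _ (Submodule.subset_span ⟨⟨j, not_le.1 hj⟩, rfl⟩)
  -- `deg (x i) ≤ deg (x k) < deg (y k) ≤ deg (y l)`, so putting `x i` in place of `y l` lowers the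
  -- order.
  have hmin := hy.2 _ _ (hy.1.update hc.symm hl)
  refine hmin.not_gt (Finset.sum_lt_sum (fun j _ => ?_) ⟨l, Finset.mem_univ l, ?_⟩)
  · by_cases hj : j = l
    · subst hj
      simpa using ((hxm hik).trans hlt.le).trans (hym hkl)
    · simp [Function.update_of_ne hj]
  · simpa using ((hxm hik).trans_lt hlt).trans_le (hym hkl)

end Exchange

/-- The list of right minimal indices of a matrix polynomial is unique. -/
theorem IsRightMinimalIndices.unique {F : Type*} [Field F] {m ι : Type*} [Fintype ι]
    {P : Matrix m ι F[X]} {ε μ : List ℕ} (hε : IsRightMinimalIndices P ε)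
    (hμ : IsRightMinimalIndices P μ) : ε = μ := by
  obtain ⟨p, x, hx, hxm, rfl⟩ := hε
  obtain ⟨q, y, hy, hym, rfl⟩ := hμ
  obtain rfl := hx.1.card_eq hy.1
  congr 1
  ext1 k
  exact (hx.vecDegree_le hy.1 hym hxm k).antisymm (hy.vecDegree_le hx.1 hxm hym k)

/-! ### Degree-shifting projections between nullspaces -/

section Transfer

variable {F : Type*} [Field F] {m m' ι ι' : Type*} [Fintype ι] [Fintype ι']

/-- Keeping only the coordinates in the image of `f` maps the polynomial vectors in the nullspace of
`Q` bijectively onto those in the nullspace of `P`, and lowers the degree of every nonzero one by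
exactly `s`. The conditions concern polynomial vectors only; the corresponding facts over the field
of rational functions follow by clearing denominators. -/
structure NullspaceProjection (Q : Matrix m ι F[X]) (P : Matrix m' ι' F[X]) (f : ι' → ι)
    (s : ℕ) : Prop where
  mulVec_eq_zero : ∀ z, Q.mulVec z = 0 → P.mulVec (z ∘ f) = 0
  eq_zero : ∀ z, Q.mulVec z = 0 → z ∘ f = 0 → z = 0
  exists_lift : ∀ x, P.mulVec x = 0 → ∃ z, Q.mulVec z = 0 ∧ z ∘ f = x
  vecDegree_eq : ∀ z, Q.mulVec z = 0 → z ≠ 0 → vecDegree z = vecDegree (z ∘ f) + s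

namespace NullspaceProjection

variable {Q : Matrix m ι F[X]} {P : Matrix m' ι' F[X]} {f : ι' → ι} {s : ℕ}

theorem map_rightNullspace (h : NullspaceProjection Q P f s) :
    (rightNullspace Q).map (LinearMap.funLeft (RatFunc F) (RatFunc F) f) = rightNullspace P := by
  ext v
  constructor
  · rintro ⟨w, hw, rfl⟩
    obtain ⟨c, z, hc, hz⟩ := exists_smul_eq_toRational w
    rw [← Submodule.smul_mem_iff _ hc, ← map_smul, hz]
    refine (toRational_mem_rightNullspace_iff P (z ∘ f)).2 (h.mulVec_eq_zero z ?_)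
    rw [← toRational_mem_rightNullspace_iff, ← hz]
    exact Submodule.smul_mem _ _ hw
  · intro hv
    obtain ⟨c, x, hc, hx⟩ := exists_smul_eq_toRational v
    obtain ⟨z, hz, rfl⟩ := h.exists_lift x (by
      rw [← toRational_mem_rightNullspace_iff, ← hx]
      exact Submodule.smul_mem _ _ hv)
    rw [← Submodule.smul_mem_iff _ hc, hx]
    exact ⟨toRational z, (toRational_mem_rightNullspace_iff Q z).2 hz, rfl⟩

/-- The projection is injective on the rational nullspace of `Q`. -/
theorem disjoint_ker (h : NullspaceProjection Q P f s) :
    Disjoint (rightNullspace Q)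
      (LinearMap.ker (LinearMap.funLeft (RatFunc F) (RatFunc F) f)) := by
  rw [Submodule.disjoint_def]
  intro w hw hw0
  obtain ⟨c, z, hc, hz⟩ := exists_smul_eq_toRational w
  have hzQ : Q.mulVec z = 0 := by
    rw [← toRational_mem_rightNullspace_iff, ← hz]
    exact Submodule.smul_mem _ _ hw
  have hzf : z ∘ f = 0 := by
    ext1 i
    apply FaithfulSMul.algebraMap_injective F[X] (RatFunc F)
    have h1 : toRational z (f i) = 0 := by
      rw [← hz]
      simpa using Or.inr (congrFun hw0 i)
    simpa [toRational] using h1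
  have h0 : c • w = 0 := by
    rw [hz, h.eq_zero z hzQ hzf]
    ext1 i
    simp [toRational]
  exact (smul_eq_zero.1 h0).resolve_left hc

variable {p : ℕ} {z : Fin p → ι → F[X]}

theorem isPolynomialBasis_iff (h : NullspaceProjection Q P f s)
    (hz : ∀ j, Q.mulVec (z j) = 0) :
    IsPolynomialBasis (rightNullspace P) (fun j => z j ∘ f) ↔
      IsPolynomialBasis (rightNullspace Q) z := by
  have hle : Submodule.span (RatFunc F) (Set.range fun j => toRational (z j)) ≤
      rightNullspace Q := by
    rw [Submodule.span_le, Set.range_subset_iff]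
    exact fun j => (toRational_mem_rightNullspace_iff Q _).2 (hz j)
  have hmap : Submodule.span (RatFunc F) (Set.range fun j => toRational (z j ∘ f)) =
      (Submodule.span (RatFunc F) (Set.range fun j => toRational (z j))).map
        (LinearMap.funLeft (RatFunc F) (RatFunc F) f) := by
    rw [Submodule.map_span, ← Set.range_comp]
    rfl
  constructor
  · rintro ⟨hli, hspan⟩
    refine ⟨LinearIndependent.of_comp (LinearMap.funLeft (RatFunc F) (RatFunc F) f) hli,
      hle.antisymm fun w hw => ?_⟩
    have hw' : LinearMap.funLeft (RatFunc F) (RatFunc F) f w ∈ rightNullspace P :=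
      h.map_rightNullspace ▸ Submodule.mem_map_of_mem hw
    rw [← hspan, hmap] at hw'
    obtain ⟨w', hw', he⟩ := hw'
    have h0 := Submodule.disjoint_def.1 h.disjoint_ker (w - w') (Submodule.sub_mem _ hw (hle hw'))
      (by rw [LinearMap.mem_ker, map_sub, he, sub_self])
    rwa [sub_eq_zero.1 h0]
  · rintro ⟨hli, hspan⟩
    refine ⟨hli.map (f := LinearMap.funLeft (RatFunc F) (RatFunc F) f) ?_, ?_⟩
    · rw [hspan]
      exact h.disjoint_ker
    · rw [hmap, hspan, h.map_rightNullspace]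

end NullspaceProjection

theorem IsPolynomialBasis.mulVec_eq_zero {Q : Matrix m ι F[X]} {p : ℕ} {z : Fin p → ι → F[X]}
    (hz : IsPolynomialBasis (rightNullspace Q) z) (j : Fin p) : Q.mulVec (z j) = 0 :=
  (toRational_mem_rightNullspace_iff Q _).1 (hz.2 ▸ Submodule.subset_span ⟨j, rfl⟩)

namespace NullspaceProjection

variable {Q : Matrix m ι F[X]} {P : Matrix m' ι' F[X]} {f : ι' → ι} {s p : ℕ}
  {z : Fin p → ι → F[X]}

theorem vecDegree_basis (h : NullspaceProjection Q P f s)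
    (hz : IsPolynomialBasis (rightNullspace Q) z) (j : Fin p) :
    vecDegree (z j) = vecDegree (z j ∘ f) + s :=
  h.vecDegree_eq _ (hz.mulVec_eq_zero j) (hz.ne_zero j)

theorem exists_basis_lift (h : NullspaceProjection Q P f s) {x : Fin p → ι' → F[X]}
    (hx : IsPolynomialBasis (rightNullspace P) x) :
    ∃ z : Fin p → ι → F[X], IsPolynomialBasis (rightNullspace Q) z ∧
      x = fun j => z j ∘ f := by
  choose z hz hzx using fun j => h.exists_lift (x j) (hx.mulVec_eq_zero j)
  obtain rfl : x = fun j => z j ∘ f := funext fun j => (hzx j).symm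
  exact ⟨z, (h.isPolynomialBasis_iff hz).1 hx, rfl⟩

theorem isRightMinimalBasis_iff (h : NullspaceProjection Q P f s)
    (hz : IsPolynomialBasis (rightNullspace Q) z) :
    IsRightMinimalBasis P (fun j => z j ∘ f) ↔ IsRightMinimalBasis Q z := by
  have hsum : ∀ {q : ℕ} {y : Fin q → ι → F[X]}, IsPolynomialBasis (rightNullspace Q) y →
      ∑ j, vecDegree (y j) = ∑ j, vecDegree (y j ∘ f) + q * s := fun hy => by
    simp_rw [h.vecDegree_basis hy, Finset.sum_add_distrib]
    simp
  refine and_congr (h.isPolynomialBasis_iff hz.mulVec_eq_zero) ⟨fun hx q y hy => ?_,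
    fun hx q y hy => ?_⟩
  · have h1 := hx q _ ((h.isPolynomialBasis_iff hy.mulVec_eq_zero).2 hy)
    obtain rfl := hz.card_eq hy
    rw [hsum hz, hsum hy]
    exact Nat.add_le_add_right h1 _
  · obtain ⟨y, hyQ, rfl⟩ := h.exists_basis_lift hy
    have h1 := hx q y hyQ
    obtain rfl := hz.card_eq hyQ
    rw [hsum hz, hsum hyQ] at h1
    exact Nat.add_le_add_iff_right.1 h1

theorem isRightMinimalIndices_map (h : NullspaceProjection Q P f s) {ε : List ℕ}
    (hε : IsRightMinimalIndices P ε) : IsRightMinimalIndices Q (ε.map fun e => e + s) := by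
  obtain ⟨p, x, hx, hxm, rfl⟩ := hε
  obtain ⟨z, hz, rfl⟩ := h.exists_basis_lift hx.1
  refine ⟨p, z, (h.isRightMinimalBasis_iff hz).1 hx, ?_, ?_⟩
  · simp_rw [h.vecDegree_basis hz]
    exact fun i j hij => Nat.add_le_add_right (hxm hij) s
  · rw [List.map_ofFn]
    simp_rw [h.vecDegree_basis hz]
    rfl

end NullspaceProjection

end Transfer

/-! ### Degrees of vector polynomials -/

section Degree

variable {F : Type*} [Field F] {m ι : Type*} [Fintype ι]

theorem natDegree_le_vecDegree (v : ι → F[X]) (i : ι) : (v i).natDegree ≤ vecDegree v :=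
  Finset.le_sup (f := fun i => (v i).natDegree) (Finset.mem_univ i)

theorem vecDegree_le_iff {v : ι → F[X]} {b : ℕ} :
    vecDegree v ≤ b ↔ ∀ i, (v i).natDegree ≤ b := by
  simp [vecDegree, Finset.sup_le_iff]

theorem natDegree_pencil_mulVec_le (A B : Matrix m ι F) (v : ι → F[X]) (i : m) :
    ((pencil A B).mulVec v i).natDegree ≤ vecDegree v + 1 := by
  refine natDegree_sum_le_of_forall_le _ _ fun j _ => natDegree_mul_le.trans ?_
  have h : (pencil A B i j).natDegree ≤ 1 := by
    simp only [pencil, Matrix.add_apply, Matrix.smul_apply, Matrix.map_apply, smul_eq_mul]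
    compute_degree
  rw [add_comm]
  exact Nat.add_le_add (natDegree_le_vecDegree v j) h

end Degree

/-! ### The nullspace equations of a block Kronecker pencil -/

section Kronecker

variable {F : Type*} [Field F] {s n : ℕ}

theorem sum_kronL_mul (i : Fin s) (U : Fin (s + 1) → F[X]) :
    ∑ k, kronL F s i k * U k = X * U i.succ - U i.castSucc := by
  have h : ∀ k, kronL F s i k * U k =
      (if k = i.succ then X * U k else 0) - (if k = i.castSucc then U k else 0) := by
    intro k
    simp only [kronL, Matrix.of_apply]
    have := (Fin.castSucc_lt_succ (i := i)).ne
    split_ifs <;> simp_all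
  simp [h, Finset.sum_sub_distrib]

/-- A row of `L_s(λ)ᵀ W`. Because `W` is zero at both ends, the first and last rows, which have only
one entry, take the same form as the others. -/
theorem sum_kronL_transpose_mul (j : Fin (s + 1)) (W : ℕ → F[X]) (h0 : W 0 = 0)
    (hs : W (s + 1) = 0) :
    ∑ i : Fin s, kronL F s i j * W (i + 1) = X * W j - W (j + 1) := by
  have h : ∀ i : Fin s, kronL F s i j * W (i + 1) =
      (if j = i.succ then X * W (i.succ : ℕ) else 0) -
        (if j = i.castSucc then W ((i.castSucc : ℕ) + 1) else 0) := by
    intro k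
    simp only [kronL, Matrix.of_apply]
    have := (Fin.castSucc_lt_succ (i := k)).ne
    split_ifs <;> simp_all
  have h1 : ∑ k : Fin (s + 1), (if j = k then X * W (k : ℕ) else 0) = X * W j := by simp
  have h2 : ∑ k : Fin (s + 1), (if j = k then W ((k : ℕ) + 1) else 0) = W (j + 1) := by simp
  rw [Fin.sum_univ_succ] at h1
  rw [Fin.sum_univ_castSucc] at h2
  simp only [h, Finset.sum_sub_distrib]
  rw [← h1, ← h2]
  simp [h0, hs]

theorem kronecker_one_mulVec {R l m : Type*} [CommSemiring R] [Fintype m]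
    (M : Matrix l m R) (v : m × Fin n → R) (i : l) (a : Fin n) :
    (M ⊗ₖ (1 : Matrix (Fin n) (Fin n) R)).mulVec v (i, a) = ∑ k, M i k * v (k, a) := by
  simp [Matrix.mulVec, dotProduct, Fintype.sum_prod_type, Matrix.one_apply]

theorem lambdaKron_mulVec (x : Fin n → F[X]) (i : Fin (s + 1)) (a : Fin n) :
    (lambdaKron F s n).mulVec x (i, a) = X ^ (s - (i : ℕ)) * x a := by
  simp [Matrix.mulVec, dotProduct, lambdaKron, kronLambda, Matrix.one_apply]

theorem lambdaKron_transpose_mulVec (v : Fin (s + 1) × Fin n → F[X]) (a : Fin n) :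
    (lambdaKron F s n).transpose.mulVec v a = ∑ i : Fin (s + 1), X ^ (s - (i : ℕ)) * v (i, a) := by
  simp [Matrix.mulVec, dotProduct, lambdaKron, kronLambda, Matrix.one_apply,
    Fintype.sum_prod_type]

theorem vecDegree_lambdaKron_mulVec {x : Fin n → F[X]} (hx : x ≠ 0) :
    vecDegree ((lambdaKron F s n).mulVec x) = vecDegree x + s := by
  apply le_antisymm
  · rw [vecDegree_le_iff]
    rintro ⟨i, a⟩
    rw [lambdaKron_mulVec]
    refine natDegree_mul_le.trans ?_
    have := natDegree_le_vecDegree x a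
    rw [natDegree_X_pow]
    omega
  · obtain ⟨b, hb⟩ := Function.ne_iff.1 hx
    have key : ∀ a, x a ≠ 0 →
        (x a).natDegree + s ≤ vecDegree ((lambdaKron F s n).mulVec x) := fun a ha => by
      have h := natDegree_le_vecDegree ((lambdaKron F s n).mulVec x) (0, a)
      rw [lambdaKron_mulVec, natDegree_mul (pow_ne_zero _ X_ne_zero) ha, natDegree_X_pow] at h
      simpa [add_comm] using h
    have hsle := key b hb
    have : vecDegree x ≤ vecDegree ((lambdaKron F s n).mulVec x) - s := by
      rw [vecDegree_le_iff]
      intro a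
      by_cases ha : x a = 0
      · simp [ha]
      · have := key a ha
        omega
    omega

variable {σ : F} {A B : Matrix (Fin (s + 1) × Fin n) (Fin (s + 1) × Fin n) F}

/-- The `a`-th entries of the `s` blocks of the lower part of `z`, placed at positions `1, …, s` of a
sequence that is zero elsewhere. -/
noncomputable def paddedBlock (z : (Fin (s + 1) × Fin n) ⊕ (Fin s × Fin n) → F[X]) (a : Fin n)
    (k : ℕ) : F[X] :=
  if h : 0 < k ∧ k ≤ s then z (Sum.inr (⟨k - 1, by omega⟩, a)) else 0

theorem paddedBlock_succ (z : (Fin (s + 1) × Fin n) ⊕ (Fin s × Fin n) → F[X]) (a : Fin n)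
    (i : Fin s) : paddedBlock z a (i + 1) = z (Sum.inr (i, a)) := by
  have : (i : ℕ) + 1 ≤ s := i.2
  simp [paddedBlock, this]

theorem paddedBlock_zero (z : (Fin (s + 1) × Fin n) ⊕ (Fin s × Fin n) → F[X]) (a : Fin n) :
    paddedBlock z a 0 = 0 := by
  simp [paddedBlock]

theorem paddedBlock_last (z : (Fin (s + 1) × Fin n) ⊕ (Fin s × Fin n) → F[X]) (a : Fin n) :
    paddedBlock z a (s + 1) = 0 := by
  simp [paddedBlock]

/-- The vectors annihilated by `L_s(λ) ⊗ I_n` are the products `(Λ_s(λ) ⊗ I_n) x`, where `x` is the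
last block. -/
theorem eq_lambdaKron_mulVec_iff (u : Fin (s + 1) × Fin n → F[X]) :
    (∀ (i : Fin s) a, X * u (i.succ, a) = u (i.castSucc, a)) ↔
      u = (lambdaKron F s n).mulVec fun a => u (Fin.last s, a) := by
  constructor
  · intro h
    ext1 ⟨i, a⟩
    rw [lambdaKron_mulVec]
    induction i using Fin.reverseInduction with
    | last => simp
    | cast i ih =>
      rw [← h, ih, ← mul_assoc, ← pow_succ']
      congr 2
      simp only [Fin.val_succ, Fin.val_castSucc]
      omega
  · intro h i a
    rw [h, lambdaKron_mulVec, lambdaKron_mulVec, ← mul_assoc, ← pow_succ']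
    congr 2
    simp only [Fin.val_succ, Fin.val_castSucc]
    omega

/-- The null vectors of the pencil: the upper part is `(Λ_s(λ) ⊗ I_n) x`, and the blocks of the lower
part satisfy a first-order recurrence that starts and ends with zero. -/
theorem blockKroneckerPencil_mulVec_eq_zero_iff (hσ : σ ≠ 0)
    (z : (Fin (s + 1) × Fin n) ⊕ (Fin s × Fin n) → F[X]) :
    (blockKroneckerPencil σ A B).mulVec z = 0 ↔
      (z ∘ Sum.inl = (lambdaKron F s n).mulVec fun a => z (Sum.inl (Fin.last s, a))) ∧
      ∀ (j : Fin (s + 1)) a, paddedBlock z a (j + 1) =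
        (pencil A B).mulVec (z ∘ Sum.inl) (j, a) + X * paddedBlock z a j := by
  have hz : z = Sum.elim (z ∘ Sum.inl) (z ∘ Sum.inr) := (Sum.elim_comp_inl_inr z).symm
  have hu := eq_lambdaKron_mulVec_iff (z ∘ Sum.inl)
  simp only [Function.comp_apply] at hu
  have htop : ∀ (j : Fin (s + 1)) (a : Fin n),
      ((kronL F s).transpose ⊗ₖ (1 : Matrix (Fin n) (Fin n) F[X])).mulVec (z ∘ Sum.inr) (j, a) =
        X * paddedBlock z a j - paddedBlock z a (j + 1) := fun j a => by
    rw [kronecker_one_mulVec, ← sum_kronL_transpose_mul j (paddedBlock z a)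
      (paddedBlock_zero z a) (paddedBlock_last z a)]
    simp [paddedBlock_succ]
  have hC : C σ ≠ 0 := by simpa using hσ
  conv_lhs => rw [hz, blockKroneckerPencil, Matrix.fromBlocks_mulVec]
  rw [← hu, funext_iff, Sum.forall, and_comm]
  simp only [Function.comp_def, Sum.elim_inl, Sum.elim_inr, Prod.forall, Pi.add_apply,
    Pi.zero_apply, Matrix.zero_mulVec, add_zero, Matrix.smul_mulVec, Pi.smul_apply, smul_eq_mul,
    mul_eq_zero, hC, false_or]
  refine and_congr (forall₂_congr fun i a => ?_) (forall₂_congr fun j a => ?_)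
  · rw [kronecker_one_mulVec, sum_kronL_mul i (fun k => z (Sum.inl (k, a))), sub_eq_zero]
  · have := htop j a
    simp only [Function.comp_def] at this
    rw [this]
    constructor <;> intro h <;> linear_combination -h

/-- Horner's scheme: the recurrence that recovers the lower blocks of a null vector of the pencil
evaluates `Λ_s(λ)ᵀ V` in its last step. -/
theorem recurrence_last_eq_sum {V : Fin (s + 1) → F[X]} {W : ℕ → F[X]} (h0 : W 0 = 0)
    (h : ∀ j : Fin (s + 1), W (j + 1) = V j + X * W j) :
    W (s + 1) = ∑ i : Fin (s + 1), X ^ (s - (i : ℕ)) * V i := by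
  have key : ∀ k (hk : k ≤ s + 1),
      W k = ∑ i : Fin k, X ^ (k - 1 - (i : ℕ)) * V (i.castLE hk) := by
    intro k
    induction k with
    | zero => simp [h0]
    | succ k ih =>
      intro hk
      have h1 := h ⟨k, hk⟩
      simp only at h1
      rw [h1, ih (by omega), Fin.sum_univ_castSucc, Finset.mul_sum, add_comm]
      congr 1
      · refine Finset.sum_congr rfl fun i _ => ?_
        rw [← mul_assoc, ← pow_succ']
        congr 2
        have := i.2
        simp only [Fin.val_castSucc]
        omega
      · simp
        rfl
  simpa using key (s + 1) le_rfl

/-- Run downwards from `W (s + 1) = 0`, the recurrence divides by `X` at each step, which makes up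
for the degree of `V` exceeding `b` by one. Run upwards it would not give this bound. -/
theorem natDegree_recurrence_le {V : Fin (s + 1) → F[X]} {W : ℕ → F[X]} {b : ℕ}
    (hs : W (s + 1) = 0) (h : ∀ j : Fin (s + 1), W (j + 1) = V j + X * W j)
    (hV : ∀ j, (V j).natDegree ≤ b + 1) (k : ℕ) (hk : k ≤ s) : (W k).natDegree ≤ b := by
  have key : ∀ j ≤ s, (W (j + 1)).natDegree ≤ b + 1 → (W j).natDegree ≤ b := by
    intro j hj hW
    by_cases hj0 : W j = 0
    · simp [hj0]
    have h1 : X * W j = W (j + 1) - V ⟨j, by omega⟩ := by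
      rw [h ⟨j, by omega⟩]
      simp
    have h2 : (X * W j).natDegree ≤ b + 1 := by
      simpa [h1] using natDegree_sub_le_of_le hW (hV ⟨j, by omega⟩)
    rw [natDegree_X_mul hj0] at h2
    omega
  induction hk using Nat.decreasingInduction with
  | self => exact key s le_rfl (by simp [hs])
  | of_succ j hj ih => exact key j hj.le (ih.trans b.le_succ)

end Kronecker

/-! ### Projection of the pencil's nullspace to the last block of its upper part -/

section Projection

variable {F : Type*} [Field F] {s n : ℕ} {σ : F}
  {A B : Matrix (Fin (s + 1) × Fin n) (Fin (s + 1) × Fin n) F} {P : Matrix (Fin n) (Fin n) F[X]}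

theorem BodyRepresents.mulVec_eq_sum (hP : BodyRepresents A B P) (x : Fin n → F[X]) (a : Fin n) :
    P.mulVec x a = ∑ i : Fin (s + 1), X ^ (s - (i : ℕ)) *
      (pencil A B).mulVec ((lambdaKron F s n).mulVec x) (i, a) := by
  rw [hP, ← Matrix.mulVec_mulVec, ← Matrix.mulVec_mulVec, lambdaKron_transpose_mulVec]

/-- Every polynomial null vector `x` of `P` is the last upper block of a polynomial null vector of
the pencil: the lower blocks come from running the recurrence upwards from zero, and `P x = 0` is
what makes it end with zero. -/
theorem exists_blockKroneckerPencil_lift (hσ : σ ≠ 0) (hP : BodyRepresents A B P)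
    (x : Fin n → F[X]) (hx : P.mulVec x = 0) :
    ∃ z, (blockKroneckerPencil σ A B).mulVec z = 0 ∧
      z ∘ (fun a => Sum.inl (Fin.last s, a)) = x := by
  set u := (lambdaKron F s n).mulVec x with hu
  have hux : ∀ a, u (Fin.last s, a) = x a := fun a => by
    rw [hu, lambdaKron_mulVec]
    simp
  let W : Fin n → ℕ → F[X] := fun a k => Nat.rec 0 (fun k r =>
    (if h : k < s + 1 then (pencil A B).mulVec u (⟨k, h⟩, a) else 0) + X * r) k
  have hW : ∀ a (j : Fin (s + 1)),
      W a (j + 1) = (pencil A B).mulVec u (j, a) + X * W a j := fun a j => by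
    have h : W a (j + 1) = (if h : (j : ℕ) < s + 1 then (pencil A B).mulVec u (⟨j, h⟩, a) else 0)
      + X * W a j := rfl
    rw [h, dif_pos j.2]
  have hlast : ∀ a, W a (s + 1) = 0 := fun a => by
    rw [recurrence_last_eq_sum (V := fun i => (pencil A B).mulVec u (i, a)) rfl (hW a),
      ← hP.mulVec_eq_sum, hx, Pi.zero_apply]
  let z : (Fin (s + 1) × Fin n) ⊕ (Fin s × Fin n) → F[X] :=
    Sum.elim u fun ia => W ia.2 (ia.1 + 1)
  have hz : ∀ a, ∀ k ≤ s + 1, paddedBlock z a k = W a k := fun a k hk => by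
    rcases k with _ | k
    · exact paddedBlock_zero z a
    · rcases Nat.lt_or_ge k s with h | h
      · exact paddedBlock_succ z a ⟨k, h⟩
      · obtain rfl : k = s := by omega
        rw [paddedBlock_last, hlast]
  refine ⟨z, (blockKroneckerPencil_mulVec_eq_zero_iff hσ z).2 ⟨?_, fun j a => ?_⟩, funext hux⟩
  · simp only [z, Sum.elim_comp_inl, Sum.elim_inl, hux]
    rfl
  · rw [hz _ _ (by omega), hz _ _ (by omega), hW]
    rfl

theorem eq_zero_of_last_block_eq_zero (hσ : σ ≠ 0)
    (z : (Fin (s + 1) × Fin n) ⊕ (Fin s × Fin n) → F[X])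
    (hz : (blockKroneckerPencil σ A B).mulVec z = 0)
    (hx : z ∘ (fun a => Sum.inl (Fin.last s, a)) = 0) : z = 0 := by
  obtain ⟨hu, hw⟩ := (blockKroneckerPencil_mulVec_eq_zero_iff hσ z).1 hz
  have hx' : (fun a => z (Sum.inl (Fin.last s, a))) = 0 := hx
  rw [hx', Matrix.mulVec_zero] at hu
  simp only [hu, Matrix.mulVec_zero, Pi.zero_apply, zero_add] at hw
  have hpad : ∀ a, ∀ k ≤ s + 1, paddedBlock z a k = 0 := fun a k => by
    induction k with
    | zero => exact fun _ => paddedBlock_zero z a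
    | succ k ih =>
      intro hk
      rw [hw ⟨k, hk⟩ a, ih (by omega), mul_zero]
  ext1 (i | ⟨i, a⟩)
  · exact congrFun hu i
  · rw [← paddedBlock_succ z a i]
    exact hpad a _ (by omega)

theorem vecDegree_eq_vecDegree_last_block_add (hσ : σ ≠ 0)
    (z : (Fin (s + 1) × Fin n) ⊕ (Fin s × Fin n) → F[X])
    (hz : (blockKroneckerPencil σ A B).mulVec z = 0) (hz0 : z ≠ 0) :
    vecDegree z = vecDegree (z ∘ (fun a => Sum.inl (Fin.last s, a))) + s := by
  obtain ⟨hu, hw⟩ := (blockKroneckerPencil_mulVec_eq_zero_iff hσ z).1 hz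
  have hx : z ∘ (fun a => Sum.inl (Fin.last s, a)) ≠ 0 :=
    fun h => hz0 (eq_zero_of_last_block_eq_zero hσ z hz h)
  have hdu : vecDegree (z ∘ Sum.inl) =
      vecDegree (z ∘ (fun a => Sum.inl (Fin.last s, a))) + s := by
    rw [hu]
    exact vecDegree_lambdaKron_mulVec hx
  rw [← hdu]
  refine le_antisymm (vecDegree_le_iff.2 ?_)
    (vecDegree_le_iff.2 fun i => natDegree_le_vecDegree z (Sum.inl i))
  rintro (i | ⟨i, a⟩)
  · exact natDegree_le_vecDegree (z ∘ Sum.inl) i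
  · rw [← paddedBlock_succ z a i]
    exact natDegree_recurrence_le (paddedBlock_last z a) (fun j => hw j a)
      (fun j => natDegree_pencil_mulVec_le A B _ (j, a)) _ i.2

theorem nullspaceProjection_blockKroneckerPencil (hσ : σ ≠ 0) (hP : BodyRepresents A B P) :
    NullspaceProjection (blockKroneckerPencil σ A B) P
      (fun a => Sum.inl (Fin.last s, a)) s where
  mulVec_eq_zero z hz := by
    obtain ⟨hu, hw⟩ := (blockKroneckerPencil_mulVec_eq_zero_iff hσ z).1 hz
    ext1 a
    rw [hP.mulVec_eq_sum, Pi.zero_apply, ← paddedBlock_last z a,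
      recurrence_last_eq_sum (paddedBlock_zero z a) (fun j => hw j a), hu]
    rfl
  eq_zero := eq_zero_of_last_block_eq_zero hσ
  exists_lift := exists_blockKroneckerPencil_lift hσ hP
  vecDegree_eq := vecDegree_eq_vecDegree_last_block_add hσ

end Projection

theorem mainTheorem7 {F : Type*} [Field F] (n d s : ℕ) (hd : d = 2 * s + 1)
    (P : Matrix (Fin n) (Fin n) F[X]) (hdeg : HasMatrixDegree P d) (hsing : P.det = 0)
    (σ : F) (hσ : σ = 1 ∨ σ = -1)
    (A B : Matrix (Fin (s + 1) × Fin n) (Fin (s + 1) × Fin n) F)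
    (hP : BodyRepresents A B P) :
    (∀ (p : ℕ) (z : Fin p → ((Fin (s + 1) × Fin n) ⊕ (Fin s × Fin n)) → F[X]),
      IsRightMinimalBasis (blockKroneckerPencil σ A B) z →
        IsRightMinimalBasis P (fun j a => z j (Sum.inl (Fin.last s, a)))) ∧
    (∀ ε : List ℕ, IsRightMinimalIndices P ε →
      ∀ μ : List ℕ, IsRightMinimalIndices (blockKroneckerPencil σ A B) μ ↔
        μ = ε.map (fun e => e + s)) := by
  have hσ0 : σ ≠ 0 := by rcases hσ with rfl | rfl <;> simp
  have h := nullspaceProjection_blockKroneckerPencil hσ0 hP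
  refine ⟨fun p z hz => (h.isRightMinimalBasis_iff hz.1).2 hz, fun ε hε μ => ?_⟩
  have hQ := h.isRightMinimalIndices_map hε
  exact ⟨fun hμ => hμ.unique hQ, fun hμ => hμ ▸ hQ⟩
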